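/- For $n\ge 1$ let $F:\mathbb C^n\to\mathbb R^n$ be the map $F(z_1,\dots,z_n)=(|z_2-z_1|,|z_3-z_2|,\dots,|z_1-z_n|)$ (side lengths of the closed planar polygon with vertices $z_1,\dots,z_n$), and let $E(2)$, the group of orientation preserving isometries of the plane $\mathbb C$, act diagonally on $\mathbb C^n$. For $\ell=(\ell_1,\dots,\ell_n)$ with all $\ell_i>0$ put $$M_\ell=F^{-1}(\ell)/E(2),\qquad K_\ell=F^{-1}(A)/E(2),$$ with the quotient topologies, where $A\subset\mathbb R^n$ is the closed segment joining $(\ell_1,\dots,\ell_{n-1},0)$ and $(\ell_1,\dots,\ell_{n-1},\ell_n)$. (For $n=1$, $M_{\ell'}$ below is taken to be a single point.) Suppose that $\ell_n$ is small in the following sense: for any choice of signs $\epsilon_j=\pm1$, $j=1,\dots,n-1$, such that $\sum_{j=1}^{n-1}\epsilon_j\ell_j>0$, one has $\sum_{j=1}^{n-1}\epsilon_j\ell_j>\ell_n$. Then $K_\ell$ is homotopy equivalent to $M_{\ell'}$, where $\ell'=(\ell_1,\dots,\ell_{n-1})$. (The vectors $\ell$ and $\ell'$ are not assumed to be generic.)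 -/

import Mathlib

noncomputable section

/-- The group `E(2)` of orientation preserving isometries of the plane `ℂ`: the affine isometries
whose linear part has positive determinant. -/
def planeMotions : Subgroup (ℂ ≃ᵃⁱ[ℝ] ℂ) where
  carrier := {g | 0 < LinearMap.det (g.linearIsometryEquiv.toLinearEquiv : ℂ →ₗ[ℝ] ℂ)}
  one_mem' := by
    change 0 < LinearMap.det (LinearMap.id : ℂ →ₗ[ℝ] ℂ)
    simp
  mul_mem' := by
    intro g h hg hh
    change 0 < LinearMap.det ((g.linearIsometryEquiv.toLinearEquiv : ℂ →ₗ[ℝ] ℂ) ∘ₗ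
      (h.linearIsometryEquiv.toLinearEquiv : ℂ →ₗ[ℝ] ℂ))
    rw [LinearMap.det_comp]
    exact mul_pos hg hh
  inv_mem' := by
    intro g hg
    change 0 < LinearMap.det (g.linearIsometryEquiv.toLinearEquiv.symm : ℂ →ₗ[ℝ] ℂ)
    have h := LinearEquiv.det_symm_mul_det g.linearIsometryEquiv.toLinearEquiv
    exact pos_of_mul_pos_left (by rw [h]; exact one_pos) (le_of_lt hg)

/-- The map `F : ℂⁿ → ℝⁿ` sending the vertices of a closed polygonal chain to its side lengths,
`F(z₁, …, zₙ) = (|z₂ - z₁|, |z₃ - z₂|, …, |z₁ - zₙ|)`. Here `finRotate n` is the cyclic shift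
`i ↦ i + 1` of the indices. -/
def sideLengths {n : ℕ} (z : Fin n → ℂ) : Fin n → ℝ :=
  fun i => ‖z (finRotate n i) - z i‖

/-- The orbit equivalence relation, on a set `S` of chains, of the diagonal action of `E(2)` on
`ℂⁿ`. -/
def shapeSetoid {n : ℕ} (S : Set (Fin n → ℂ)) : Setoid S where
  r z w := ∃ g ∈ planeMotions, ∀ i, w.1 i = g (z.1 i)
  iseqv :=
    { refl := fun _ => ⟨1, planeMotions.one_mem, fun _ => rfl⟩
      symm := by
        rintro z w ⟨g, hg, h⟩
        refine ⟨g⁻¹, planeMotions.inv_mem hg, fun i => ?_⟩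
        rw [h i]
        exact (g.symm_apply_apply (z.1 i)).symm
      trans := by
        rintro z w v ⟨g, hg, h⟩ ⟨k, hk, h'⟩
        refine ⟨k * g, planeMotions.mul_mem hk hg, fun i => ?_⟩
        rw [h' i, h i]
        rfl }

/-- The space `F⁻¹(B) / E(2)`, with the quotient topology of the subspace topology of
`F⁻¹(B) ⊆ ℂⁿ`. -/
abbrev ShapeSpace {n : ℕ} (B : Set (Fin n → ℝ)) : Type :=
  Quotient (shapeSetoid (sideLengths ⁻¹' B))

/-- The polygon space `M_ℓ = F⁻¹(ℓ) / E(2)` of closed chains with side lengths `ℓ`. -/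
abbrev PolygonSpace {n : ℕ} (l : Fin n → ℝ) : Type :=
  ShapeSpace {l}

/-- The configuration space `K_ℓ = F⁻¹(A) / E(2)` of closed chains whose last side is a telescopic
leg; `A` is the closed segment from `(ℓ₁, …, ℓₙ₋₁, 0)` to `(ℓ₁, …, ℓₙ₋₁, ℓₙ)`. The number of
sides is `n + 1` in the notation of this definition. -/
abbrev TelescopicSpace {n : ℕ} (l : Fin (n + 1) → ℝ) : Type :=
  ShapeSpace (segment ℝ (Function.update l (Fin.last n) 0) l)

end

/-!
Dividing out the motions, `K_ℓ` becomes the space of unit vectors `e₀ = 1, e₁, …, eₙ₋₂` of edge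
directions whose resultant `g = ∑ lᵢ eᵢ`, summed over the edges other than the telescopic one, has
length `r ≤ c`, where `c` is the length of the telescopic leg, and `M_ℓ'` becomes the subspace
`r = 0` (`nonempty_homeomorph_directionSlice`). It remains to retract the former onto the latter.

Away from `r = 0` the critical points of `r²` are the collinear systems, where `r = |∑ εᵢ lᵢ|` for
some signs; by the smallness of `c` none of them has `0 < r ≤ c`. Since `ℓ'` need not be generic,
the level `r = 0` may be singular, and the absence of critical values in `(0, c]` is not enough.
What replaces regularity is a Łojasiewicz inequality `∑ lᵢ τᵢ² ≥ κ r³`, where `-2 lᵢ τᵢ` is the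
derivative of `r²` with respect to the angle of the `i`-th edge (`exists_lojasiewicz`); here it has
an elementary proof.

Hence one step of gradient descent with a small fixed step size moves each point by at most a
constant times the decrease of `√r`. The displacements therefore telescope, the infinite
composition of descent steps converges uniformly, and its limit is a deformation onto the zero set
(`nonempty_homotopyEquiv_zeros`). Discrete steps avoid the flow of a differential equation.
-/

/-! ### Infinite composition of descent steps -/

open Filter Topology in
/-- A sequence of maps that stays, from the index `N` on, within `ε` of its `N`-th term converges
uniformly, and the limit of continuous maps is continuous. -/
theorem exists_continuous_limit {X Y : Type*} [TopologicalSpace X] [MetricSpace Y]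
    [CompleteSpace Y] (H : ℕ → X → Y) (hc : ∀ k, Continuous (H k))
    (hH : ∀ ε > 0, ∃ N, ∀ k ≥ N, ∀ p, dist (H k p) (H N p) ≤ ε) :
    ∃ L : X → Y, Continuous L ∧ ∀ p, Tendsto (fun k => H k p) atTop (𝓝 (L p)) := by
  have hu : UniformCauchySeqOn H atTop Set.univ := by
    rw [Metric.uniformCauchySeqOn_iff]
    intro ε hε
    obtain ⟨N, hN⟩ := hH (ε / 3) (by positivity)
    refine ⟨N, fun j hj k hk p _ => ?_⟩
    have := dist_triangle_right (H j p) (H k p) (H N p)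
    linarith [hN j hj p, hN k hk p]
  have hex : ∀ p, ∃ y, Tendsto (fun k => H k p) atTop (𝓝 y) := fun p =>
    cauchySeq_tendsto_of_complete (hu.cauchySeq (Set.mem_univ p))
  choose L hL using hex
  refine ⟨L, ?_, hL⟩
  have := hu.tendstoUniformlyOn_of_tendsto (fun p _ => hL p)
  rw [tendstoUniformlyOn_univ] at this
  exact this.continuous (Frequently.of_forall hc)

/-- The time allotted to the `k`-th step of an infinite composition, as a function of the global
time `t`: it vanishes up to `t = k / (k + 1)` and equals `1` from `t = (k + 1) / (k + 2)` on, so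
that the steps are performed one after the other and are all completed at `t = 1`. -/
noncomputable def stepTime (k : ℕ) (t : unitInterval) : unitInterval :=
  Set.projIcc 0 1 zero_le_one ((k + 2) * (1 - (k + 1) * (1 - (t : ℝ))))

theorem continuous_stepTime (k : ℕ) : Continuous (stepTime k) := by
  unfold stepTime
  exact continuous_projIcc.comp (by fun_prop)

theorem stepTime_zero (k : ℕ) : stepTime k 0 = 0 := by
  refine Set.projIcc_of_le_left zero_le_one ?_
  have : (0 : ℝ) ≤ k := k.cast_nonneg
  simp only [Set.Icc.coe_zero]
  nlinarith

theorem stepTime_one (k : ℕ) : stepTime k 1 = 1 := by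
  refine Set.projIcc_of_right_le zero_le_one ?_
  have : (0 : ℝ) ≤ k := k.cast_nonneg
  simp only [Set.Icc.coe_one]
  linarith

/-- A step starts only when all previous steps are completed. -/
theorem stepTime_eq_one_of_lt {j k : ℕ} (hjk : j < k) {t : unitInterval} (ht : stepTime k t ≠ 0) :
    stepTime j t = 1 := by
  have h1 : (0 : ℝ) < (k + 2) * (1 - (k + 1) * (1 - (t : ℝ))) := by
    by_contra hle
    exact ht (Set.projIcc_of_le_left zero_le_one (not_lt.mp hle))
  have hk : (0 : ℝ) < (k : ℝ) + 2 := by positivity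
  have h2 : (0 : ℝ) < 1 - (k + 1) * (1 - (t : ℝ)) := pos_of_mul_pos_right h1 hk.le
  refine Set.projIcc_of_right_le zero_le_one ?_
  have hj : (0 : ℝ) ≤ j := j.cast_nonneg
  have hjk' : (j : ℝ) + 1 ≤ k := by exact_mod_cast hjk
  have ht1 : (0 : ℝ) ≤ 1 - t := by linarith [t.2.2]
  have h3 : ((j : ℝ) + 2) * (1 - t) ≤ (k + 1) * (1 - t) :=
    mul_le_mul_of_nonneg_right (by linarith) ht1
  nlinarith

/-- The composition of the first `k` steps `D`, the `j`-th of them run for the time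
`stepTime j t`. -/
noncomputable def iterateStep {Y : Type*} (D : Y × unitInterval → Y) : ℕ → Y × unitInterval → Y
  | 0, p => p.1
  | k + 1, p => D (iterateStep D k p, stepTime k p.2)

theorem continuous_iterateStep {Y : Type*} [TopologicalSpace Y] {D : Y × unitInterval → Y}
    (hD : Continuous D) (k : ℕ) : Continuous (iterateStep D k) := by
  induction k with
  | zero => exact continuous_fst
  | succ k ih => exact hD.comp (ih.prodMk ((continuous_stepTime k).comp continuous_snd))

theorem iterateStep_time_zero {Y : Type*} {D : Y × unitInterval → Y}
    (hD0 : ∀ y, D (y, 0) = y) (k : ℕ) (y : Y) : iterateStep D k (y, 0) = y := by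
  induction k with
  | zero => rfl
  | succ k ih => simp only [iterateStep, stepTime_zero, hD0, ih]

/-- Displacements telescope: they are controlled by the total decrease of the potential `φ`. -/
theorem dist_iterateStep_le {Y : Type*} [MetricSpace Y] {D : Y × unitInterval → Y} {φ : Y → ℝ}
    (hdist : ∀ y s, dist y (D (y, s)) ≤ φ y - φ (D (y, s))) {N k : ℕ} (hk : N ≤ k)
    (p : Y × unitInterval) :
    dist (iterateStep D k p) (iterateStep D N p) ≤
      φ (iterateStep D N p) - φ (iterateStep D k p) := by
  induction k, hk using Nat.le_induction with
  | base => simp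
  | succ k _ ih =>
    have h1 := hdist (iterateStep D k p) (stepTime k p.2)
    have h2 := dist_triangle_left (iterateStep D (k + 1) p) (iterateStep D N p) (iterateStep D k p)
    simp only [iterateStep] at h2 ⊢
    linarith

/-- If the potential decreases by a definite amount as long as it is at least `ε`, then after
finitely many completed steps, uniformly in the initial point, it is smaller than `ε`. -/
theorem exists_iterate_lt {Y : Type*} [MetricSpace Y] {D : Y × unitInterval → Y} {φ : Y → ℝ}
    {B : ℝ} (hφB : ∀ y, φ y ≤ B)
    (hdist : ∀ y s, dist y (D (y, s)) ≤ φ y - φ (D (y, s)))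
    (hdec : ∀ ε > 0, ∃ δ > 0, ∀ y, ε ≤ φ y → φ (D (y, 1)) ≤ φ y - δ) {ε : ℝ} (hε : 0 < ε) :
    ∃ N : ℕ, ∀ p, (∀ j < N, stepTime j p.2 = 1) → φ (iterateStep D N p) < ε := by
  obtain ⟨δ, hδ, h⟩ := hdec ε hε
  obtain ⟨N, hN⟩ := exists_nat_gt ((B - ε) / δ)
  rw [div_lt_iff₀ hδ] at hN
  refine ⟨N, fun p hp => ?_⟩
  by_contra! hge
  have key : ∀ k ≤ N, φ (iterateStep D k p) ≤ B - k * δ := by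
    intro k hk
    induction k with
    | zero => simpa [iterateStep] using hφB p.1
    | succ k ih =>
      have h1 := dist_iterateStep_le hdist (Nat.le_of_succ_le hk) p
      have h2 : ε ≤ φ (iterateStep D k p) := by
        linarith [dist_nonneg (x := iterateStep D N p) (y := iterateStep D k p)]
      have h3 := h _ h2
      have h4 := ih (Nat.le_of_succ_le hk)
      simp only [iterateStep, hp k hk]
      push_cast
      linarith
  linarith [key N le_rfl]

open Filter Topology in
/-- If a continuous family of steps `D (y, s)`, `s ∈ [0, 1]`, with `D (y, 0) = y`, moves each point
by at most the decrease of a bounded potential `φ ≥ 0`, and the complete step decreases `φ` by a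
definite amount away from the zeros of `φ`, then the whole space is homotopy equivalent to the zero
set of `φ`. The infinite composition of the steps is a deformation that keeps the zeros fixed. -/
theorem nonempty_homotopyEquiv_zeros {Y : Type*} [MetricSpace Y] [CompleteSpace Y]
    {D : Y × unitInterval → Y} (hD : Continuous D) (hD0 : ∀ y, D (y, 0) = y)
    {φ : Y → ℝ} (hφ : Continuous φ) (hφ0 : ∀ y, 0 ≤ φ y) {B : ℝ} (hφB : ∀ y, φ y ≤ B)
    (hdist : ∀ y s, dist y (D (y, s)) ≤ φ y - φ (D (y, s)))
    (hdec : ∀ ε > 0, ∃ δ > 0, ∀ y, ε ≤ φ y → φ (D (y, 1)) ≤ φ y - δ) :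
    Nonempty (ContinuousMap.HomotopyEquiv Y {y : Y // φ y = 0}) := by
  have hdistN := fun {N k : ℕ} (hk : N ≤ k) p => dist_iterateStep_le (D := D) hdist hk p
  obtain ⟨L, hLc, hL⟩ := exists_continuous_limit (iterateStep D) (continuous_iterateStep hD) (by
    intro ε hε
    obtain ⟨N, hN⟩ := exists_iterate_lt hφB hdist hdec hε
    refine ⟨N, fun k hk p => ?_⟩
    by_cases hs : ∀ j ≥ N, stepTime j p.2 = 0
    -- no step is started after the `N`-th one
    · have : iterateStep D k p = iterateStep D N p := by
        induction k, hk using Nat.le_induction with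
        | base => rfl
        | succ k hk ih => simp only [iterateStep, hs k hk, hD0, ih]
      rw [this, dist_self]
      exact hε.le
    · push Not at hs
      obtain ⟨j, hj, hj0⟩ := hs
      have := hN p (fun i hi => stepTime_eq_one_of_lt (hi.trans_le hj) hj0)
      linarith [hdistN hk p, hφ0 (iterateStep D k p)])
  have hL0 : ∀ y, L (y, 0) = y := fun y =>
    tendsto_nhds_unique (hL (y, 0)) (by simp [iterateStep_time_zero hD0])
  have hφL : ∀ p k, φ (L p) ≤ φ (iterateStep D k p) := fun p k =>
    le_of_tendsto ((hφ.tendsto _).comp (hL p)) (eventually_atTop.mpr ⟨k, fun j hj => by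
      have := hdistN hj p
      simp only [Function.comp]
      linarith [dist_nonneg (x := iterateStep D j p) (y := iterateStep D k p)]⟩)
  have hL1 : ∀ y, φ (L (y, 1)) = 0 := fun y => by
    refine le_antisymm (le_of_forall_pos_le_add fun ε hε => ?_) (hφ0 _)
    obtain ⟨N, hN⟩ := exists_iterate_lt hφB hdist hdec hε
    linarith [hφL (y, 1) N, hN (y, 1) (fun j _ => stepTime_one j)]
  have hfix : ∀ y, φ y = 0 → ∀ t, L (y, t) = y := fun y hy t => by
    refine tendsto_nhds_unique (hL (y, t)) (tendsto_const_nhds.congr fun k => ?_)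
    have h := hdistN (Nat.zero_le k) (y, t)
    simp only [iterateStep, hy] at h
    exact (dist_le_zero.mp (h.trans (by linarith [hφ0 (iterateStep D k (y, t))]))).symm
  let r : C(Y, {y : Y // φ y = 0}) := ⟨fun y => ⟨L (y, 1), hL1 y⟩, by fun_prop⟩
  let ι : C({y : Y // φ y = 0}, Y) := ⟨Subtype.val, continuous_subtype_val⟩
  refine ⟨⟨r, ι, ContinuousMap.Homotopic.symm ⟨?_⟩, ?_⟩⟩
  · exact
      { toFun := fun p => L (p.2, p.1)
        continuous_toFun := by fun_prop
        map_zero_left := fun y => hL0 y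
        map_one_left := fun y => rfl }
  · have : r.comp ι = ContinuousMap.id _ := by
      ext y
      exact hfix y.1 y.2 1
    rw [this]

/-! ### Gradient descent for the length of the resultant -/

/-- The resultant `∑ lᵢ eᵢ` of edges with lengths `lᵢ` and directions `eᵢ`. -/
noncomputable def resultant {ι : Type*} [Fintype ι] (l : ι → ℝ) (e : ι → ℂ) : ℂ :=
  ∑ i, (l i : ℂ) * e i

/-- The scalar product of `eᵢ` with the resultant turned by a right angle; up to a positive factor
it is minus the derivative of the squared length of the resultant with respect to the angle of the
`i`-th edge. -/
noncomputable def torque {ι : Type*} [Fintype ι] (l : ι → ℝ) (e : ι → ℂ) (i : ι) : ℝ :=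
  (starRingEnd ℂ (resultant l e) * e i).im

/-- A step of gradient descent for the squared length of the resultant, with respect to the metric
`∑ lᵢ dθᵢ²` on the space of edge angles `θᵢ`: each edge is turned by `a` times its torque. The whole
system is then rotated so that `e i₀` returns to its place. -/
noncomputable def descentStep {ι : Type*} [Fintype ι] (l : ι → ℝ) (i₀ : ι) (a : ℝ) (e : ι → ℂ)
    (i : ι) : ℂ :=
  Complex.exp (Complex.I * ((a * (torque l e i - torque l e i₀) : ℝ) : ℂ)) * e i

section
variable {ι : Type*} [Fintype ι] {l : ι → ℝ} {e : ι → ℂ}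

theorem norm_resultant_le (hl : ∀ i, 0 ≤ l i) (he : ∀ i, ‖e i‖ = 1) :
    ‖resultant l e‖ ≤ ∑ i, l i := by
  refine (norm_sum_le _ _).trans (Finset.sum_le_sum fun i _ => ?_)
  simp [he i, abs_of_nonneg (hl i)]

theorem abs_torque_le (he : ∀ i, ‖e i‖ = 1) (i : ι) : |torque l e i| ≤ ‖resultant l e‖ := by
  refine (Complex.abs_im_le_norm _).trans ?_
  simp [he i]

theorem norm_descentStep (i₀ : ι) (a : ℝ) (i : ι) : ‖descentStep l i₀ a e i‖ = ‖e i‖ := by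
  rw [descentStep, norm_mul, mul_comm Complex.I, Complex.norm_exp_ofReal_mul_I, one_mul]

theorem continuous_descentStep (l : ι → ℝ) (i₀ : ι) :
    Continuous fun p : ℝ × (ι → ℂ) => descentStep l i₀ p.1 p.2 := by
  unfold descentStep torque resultant
  fun_prop

theorem norm_sub_descentStep_le (he : ∀ i, ‖e i‖ = 1) {a : ℝ} (ha : 0 ≤ a) (i₀ i : ι) :
    ‖e i - descentStep l i₀ a e i‖ ≤ a * (|torque l e i| + |torque l e i₀|) := by
  have h : e i - descentStep l i₀ a e i = -((Complex.exp (Complex.I *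
      ((a * (torque l e i - torque l e i₀) : ℝ) : ℂ)) - 1) * e i) := by
    rw [descentStep]; ring
  rw [h, norm_neg, norm_mul, he i, mul_one]
  refine Real.norm_exp_I_mul_ofReal_sub_one_le.trans ?_
  rw [Real.norm_eq_abs, abs_mul, abs_of_nonneg ha]
  exact mul_le_mul_of_nonneg_left (abs_sub _ _) ha

/-- The final rotation of `descentStep` does not affect the length of the resultant. -/
theorem norm_resultant_descentStep (i₀ : ι) (a : ℝ) :
    ‖resultant l (descentStep l i₀ a e)‖ =
      ‖resultant l fun i => Complex.exp (Complex.I * ((a * torque l e i : ℝ) : ℂ)) * e i‖ := by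
  have h : resultant l (descentStep l i₀ a e) =
      Complex.exp (((-(a * torque l e i₀) : ℝ) : ℂ) * Complex.I) *
        resultant l fun i => Complex.exp (Complex.I * ((a * torque l e i : ℝ) : ℂ)) * e i := by
    simp only [resultant, Finset.mul_sum, descentStep]
    refine Finset.sum_congr rfl fun i _ => ?_
    have : Complex.I * ((a * (torque l e i - torque l e i₀) : ℝ) : ℂ) =
        ((-(a * torque l e i₀) : ℝ) : ℂ) * Complex.I +
          Complex.I * ((a * torque l e i : ℝ) : ℂ) := by
      push_cast; ring
    rw [this, Complex.exp_add]
    ring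
  rw [h, norm_mul, Complex.norm_exp_ofReal_mul_I, one_mul]

/-- For a small step size the squared length of the resultant decreases at least by half of its
first order variation. -/
theorem sq_norm_resultant_descentStep_le (hl : ∀ i, 0 ≤ l i) (he : ∀ i, ‖e i‖ = 1) (i₀ : ι)
    {a : ℝ} (ha : 0 ≤ a) (haL : 3 * (∑ i, l i) * a ≤ 1) :
    ‖resultant l (descentStep l i₀ a e)‖ ^ 2 ≤
      ‖resultant l e‖ ^ 2 - a * ∑ i, l i * torque l e i ^ 2 := by
  rw [norm_resultant_descentStep]
  set L := ∑ i, l i with hL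
  set g := resultant l e with hg
  set P := ∑ i, l i * torque l e i ^ 2 with hP
  have hP0 : 0 ≤ P := Finset.sum_nonneg fun i _ => mul_nonneg (hl i) (sq_nonneg _)
  have hL0 : 0 ≤ L := Finset.sum_nonneg fun i _ => hl i
  have hgL : ‖g‖ ≤ L := norm_resultant_le hl he
  have hx : ∀ i, |a * torque l e i| ≤ 1 := fun i => by
    rw [abs_mul, abs_of_nonneg ha]
    have h1 : |torque l e i| ≤ L := (abs_torque_le he i).trans hgL
    nlinarith [mul_le_mul_of_nonneg_left h1 ha, mul_nonneg hL0 ha]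
  set w : ι → ℂ := fun i => Complex.exp (Complex.I * ((a * torque l e i : ℝ) : ℂ)) - 1 with hw
  set d : ℂ := ∑ i, (l i : ℂ) * (w i * e i) with hd
  have hsum : (resultant l fun i =>
      Complex.exp (Complex.I * ((a * torque l e i : ℝ) : ℂ)) * e i) = g + d := by
    simp only [hg, hd, hw, resultant, ← Finset.sum_add_distrib]
    exact Finset.sum_congr rfl fun i _ => by ring
  -- the square of the displacement of the resultant, by the Cauchy-Schwarz inequality
  have hd2 : ‖d‖ ^ 2 ≤ L * (a ^ 2 * P) := by
    have h1 : ‖d‖ ≤ ∑ i, l i * |a * torque l e i| := by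
      refine (norm_sum_le _ _).trans (Finset.sum_le_sum fun i _ => ?_)
      rw [norm_mul, norm_mul, he i, mul_one, Complex.norm_real, Real.norm_eq_abs,
        abs_of_nonneg (hl i)]
      exact mul_le_mul_of_nonneg_left Real.norm_exp_I_mul_ofReal_sub_one_le (hl i)
    have h2 : (∑ i, l i * |a * torque l e i|) ^ 2 ≤
        (∑ i, l i) * ∑ i, l i * (a * torque l e i) ^ 2 :=
      Finset.sum_sq_le_sum_mul_sum_of_sq_le_mul _ (fun i _ => hl i)
        (fun i _ => mul_nonneg (hl i) (sq_nonneg _)) fun i _ => by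
          rw [mul_pow, sq_abs]; exact le_of_eq (by ring)
    have h3 : ∑ i, l i * (a * torque l e i) ^ 2 = a ^ 2 * P := by
      rw [hP, Finset.mul_sum]
      exact Finset.sum_congr rfl fun i _ => by ring
    rw [h3] at h2
    exact (pow_le_pow_left₀ (norm_nonneg _) h1 2).trans h2
  -- the first order variation, with a quadratic error
  have hre : (starRingEnd ℂ g * d).re ≤ -(a * P) + L * (a ^ 2 * P) := by
    have hterm : ∀ i, (starRingEnd ℂ g * (w i * e i)).re ≤
        -(a * torque l e i ^ 2) + L * (a * torque l e i) ^ 2 := fun i => by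
      have h1 : starRingEnd ℂ g * (w i * e i) =
          ((a * torque l e i : ℝ) : ℂ) * (Complex.I * (starRingEnd ℂ g * e i)) +
          (w i - Complex.I * ((a * torque l e i : ℝ) : ℂ)) * (starRingEnd ℂ g * e i) := by ring
      have h2 : ‖w i - Complex.I * ((a * torque l e i : ℝ) : ℂ)‖ ≤ (a * torque l e i) ^ 2 := by
        have h3 : ‖Complex.I * ((a * torque l e i : ℝ) : ℂ)‖ = |a * torque l e i| := by
          rw [norm_mul, Complex.norm_I, one_mul, Complex.norm_real, Real.norm_eq_abs]
        have := Complex.norm_exp_sub_one_sub_id_le (h3.trans_le (hx i))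
        rwa [h3, sq_abs] at this
      have h4 : ((w i - Complex.I * ((a * torque l e i : ℝ) : ℂ)) *
          (starRingEnd ℂ g * e i)).re ≤ (a * torque l e i) ^ 2 * L := by
        refine (Complex.re_le_norm _).trans ?_
        rw [norm_mul, norm_mul, he i, mul_one, RCLike.norm_conj]
        exact mul_le_mul h2 hgL (norm_nonneg _) (sq_nonneg _)
      have h5 : (((a * torque l e i : ℝ) : ℂ) * (Complex.I * (starRingEnd ℂ g * e i))).re =
          -(a * torque l e i ^ 2) := by
        rw [Complex.re_ofReal_mul, Complex.I_mul_re]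
        change a * torque l e i * -torque l e i = _
        ring
      rw [h1, Complex.add_re, h5]
      linarith
    have h6 : (starRingEnd ℂ g * d).re = ∑ i, l i * (starRingEnd ℂ g * (w i * e i)).re := by
      rw [hd, Finset.mul_sum, Complex.re_sum]
      refine Finset.sum_congr rfl fun i _ => ?_
      rw [mul_left_comm, Complex.re_ofReal_mul]
    rw [h6]
    refine (Finset.sum_le_sum fun i _ => mul_le_mul_of_nonneg_left (hterm i) (hl i)).trans_eq ?_
    rw [hP, Finset.mul_sum, Finset.mul_sum, Finset.mul_sum, ← Finset.sum_neg_distrib,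
      ← Finset.sum_add_distrib]
    exact Finset.sum_congr rfl fun i _ => by ring
  have hexp : ‖g + d‖ ^ 2 = ‖g‖ ^ 2 + 2 * (starRingEnd ℂ g * d).re + ‖d‖ ^ 2 := by
    simp only [← Complex.normSq_eq_norm_sq, Complex.normSq_apply, Complex.add_re, Complex.add_im,
      Complex.mul_re, Complex.conj_re, Complex.conj_im]
    ring
  rw [hsum, hexp]
  have haP : 0 ≤ a * P := mul_nonneg ha hP0
  nlinarith [mul_le_mul_of_nonneg_right haL haP]

/-! ### An explicit Łojasiewicz inequality -/

/-- A finite set of positive gaps has a positive minimum. -/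
theorem exists_sign_gap (l : ι → ℝ) {c : ℝ}
    (hsmall : ∀ ε : ι → ℝ, (∀ j, ε j = 1 ∨ ε j = -1) → 0 < ∑ j, ε j * l j → c < ∑ j, ε j * l j) :
    ∃ δ > 0, ∀ ε : ι → ℝ, (∀ j, ε j = 1 ∨ ε j = -1) → 0 < ∑ j, ε j * l j →
      c + δ ≤ ∑ j, ε j * l j := by
  classical
  set S : Set (ι → ℝ) := {ε | (∀ j, ε j = 1 ∨ ε j = -1) ∧ 0 < ∑ j, ε j * l j}
  have hS : S.Finite := by
    refine (Set.Finite.pi (t := fun _ : ι => ({1, -1} : Set ℝ)) fun _ => Set.toFinite _).subset ?_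
    intro ε hε j _
    exact hε.1 j
  rcases S.eq_empty_or_nonempty with h | h
  · exact ⟨1, one_pos, fun ε h1 h2 => absurd (show ε ∈ S from ⟨h1, h2⟩) (by simp [h])⟩
  · obtain ⟨ε₀, h₀, hmin⟩ := Set.exists_min_image S (fun ε => ∑ j, ε j * l j) hS h
    refine ⟨∑ j, ε₀ j * l j - c, sub_pos.mpr (hsmall ε₀ h₀.1 h₀.2), fun ε h1 h2 => ?_⟩
    linarith [hmin ε ⟨h1, h2⟩]

/-- Where the length `r` of the resultant is at most `c`, the squared norm of the gradient of `r²`,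
which is `4 ∑ lᵢ torqueᵢ²` for the metric `∑ lᵢ dθᵢ²`, is at least a multiple of `r³`. With the
signs `εᵢ` of the scalar products of `eᵢ` with the resultant, `r` differs from `∑ εᵢ lᵢ` by at most
the sum of the `lᵢ` times the squared sines of the angles between `eᵢ` and the resultant, whereas
`∑ εᵢ lᵢ` is either nonpositive or larger than `c` by a fixed amount. -/
theorem exists_lojasiewicz (hl : ∀ i, 0 ≤ l i) {c : ℝ} (hc : 0 < c)
    (hsmall : ∀ ε : ι → ℝ, (∀ j, ε j = 1 ∨ ε j = -1) → 0 < ∑ j, ε j * l j → c < ∑ j, ε j * l j) :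
    ∃ κ > 0, ∀ e : ι → ℂ, (∀ i, ‖e i‖ = 1) → ‖resultant l e‖ ≤ c →
      κ * ‖resultant l e‖ ^ 3 ≤ ∑ i, l i * torque l e i ^ 2 := by
  obtain ⟨δ, hδ, hgap⟩ := exists_sign_gap l hsmall
  refine ⟨min 1 (δ / c), lt_min one_pos (div_pos hδ hc), fun e he hec => ?_⟩
  set g := resultant l e with hg
  set r := ‖g‖ with hr
  set P := ∑ i, l i * torque l e i ^ 2 with hP
  rcases (norm_nonneg g).eq_or_lt with h0 | hpos
  · rw [hr, ← h0]
    simpa using Finset.sum_nonneg fun i _ => mul_nonneg (hl i) (sq_nonneg (torque l e i))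
  set q : ι → ℝ := fun i => (starRingEnd ℂ g * e i).re with hq
  have hpq : ∀ i, torque l e i ^ 2 + q i ^ 2 = r ^ 2 := fun i => by
    have h1 : ‖starRingEnd ℂ g * e i‖ = r := by
      rw [norm_mul, he i, mul_one, RCLike.norm_conj]
    rw [← h1, ← Complex.normSq_eq_norm_sq, Complex.normSq_apply, torque, ← hg]
    simp only [hq]
    ring
  have hqsum : ∑ i, l i * q i = r ^ 2 := by
    have h1 : starRingEnd ℂ g * g = ((r ^ 2 : ℝ) : ℂ) := by
      rw [mul_comm, Complex.mul_conj, Complex.normSq_eq_norm_sq]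
    have h2 : (starRingEnd ℂ g * ∑ i, (l i : ℂ) * e i).re = r ^ 2 := by
      change (starRingEnd ℂ g * g).re = _
      rw [h1, Complex.ofReal_re]
    rw [← h2, Finset.mul_sum, Complex.re_sum]
    refine Finset.sum_congr rfl fun i _ => ?_
    rw [mul_left_comm, Complex.re_ofReal_mul]
  set ε : ι → ℝ := fun i => if 0 ≤ q i then 1 else -1 with hε
  have hε1 : ∀ i, ε i = 1 ∨ ε i = -1 := fun i => by
    simp only [hε]; split_ifs <;> simp
  have hεq : ∀ i, ε i * |q i| = q i := fun i => by
    simp only [hε]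
    split_ifs with h
    · rw [abs_of_nonneg h, one_mul]
    · rw [abs_of_neg (not_le.mp h)]; ring
  have hqr : ∀ i, |q i| ≤ r := fun i =>
    abs_le_of_sq_le_sq (by nlinarith [hpq i, sq_nonneg (torque l e i)]) hpos.le
  -- `r (r - |qᵢ|) ≤ r² - qᵢ²`
  have hterm : ∀ i, r * (r - |q i|) ≤ torque l e i ^ 2 := fun i => by
    have h1 := hpq i
    rw [← sq_abs (q i)] at h1
    nlinarith [hqr i, abs_nonneg (q i)]
  have hsum : r * ∑ i, l i * (r - |q i|) ≤ P := by
    rw [hP, Finset.mul_sum]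
    refine Finset.sum_le_sum fun i _ => ?_
    rw [mul_left_comm]
    exact mul_le_mul_of_nonneg_left (hterm i) (hl i)
  have hdef : r * ∑ i, ε i * l i - r ^ 2 = ∑ i, ε i * (l i * (r - |q i|)) := by
    rw [← hqsum, Finset.mul_sum, ← Finset.sum_sub_distrib]
    refine Finset.sum_congr rfl fun i _ => ?_
    linear_combination l i * hεq i
  have hdefabs : |r * ∑ i, ε i * l i - r ^ 2| ≤ ∑ i, l i * (r - |q i|) := by
    rw [hdef]
    refine (Finset.abs_sum_le_sum_abs _ _).trans (Finset.sum_le_sum fun i _ => ?_)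
    rw [abs_mul, abs_of_nonneg (mul_nonneg (hl i) (sub_nonneg.mpr (hqr i)))]
    rcases hε1 i with h | h <;> simp [h]
  have habs := abs_le.mp hdefabs
  by_cases hσ : 0 < ∑ i, ε i * l i
  · have h1 := hgap ε hε1 hσ
    have h2 : r * δ ≤ ∑ i, l i * (r - |q i|) := by nlinarith [habs.2]
    have h3 : r * (r * δ) ≤ P := (mul_le_mul_of_nonneg_left h2 hpos.le).trans hsum
    have h4 : δ / c * r ^ 3 ≤ r * (r * δ) := by
      rw [div_mul_eq_mul_div, div_le_iff₀ hc]
      have : 0 ≤ r ^ 2 * δ := by positivity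
      nlinarith
    exact (mul_le_mul_of_nonneg_right (min_le_right _ _) (by positivity)).trans (h4.trans h3)
  · have h2 : r ^ 2 ≤ ∑ i, l i * (r - |q i|) := by nlinarith [habs.1]
    have h3 : r * r ^ 2 ≤ P := (mul_le_mul_of_nonneg_left h2 hpos.le).trans hsum
    refine (mul_le_mul_of_nonneg_right (min_le_left _ _) (by positivity)).trans ?_
    linarith [show r * r ^ 2 = 1 * r ^ 3 by ring]

end

/-! ### The deformation of the space of edge directions -/

/-- The systems of edge directions, normalized by the condition that the edge `i₀` points in the
direction `1`, for which the length of the resultant lies in `J`. -/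
def directionSlice {ι : Type*} [Fintype ι] (l : ι → ℝ) (i₀ : ι) (J : Set ℝ) : Set (ι → ℂ) :=
  {e | (∀ i, ‖e i‖ = 1) ∧ e i₀ = 1 ∧ ‖resultant l e‖ ∈ J}

section
variable {ι : Type*} [Fintype ι]

theorem continuous_resultant (l : ι → ℝ) : Continuous (resultant l) := by
  unfold resultant
  fun_prop

theorem isClosed_directionSlice (l : ι → ℝ) (i₀ : ι) {J : Set ℝ} (hJ : IsClosed J) :
    IsClosed (directionSlice l i₀ J) := by
  refine IsClosed.inter (s₁ := {e | ∀ i, ‖e i‖ = 1}) ?_ (IsClosed.inter (s₁ := {e | e i₀ = 1}) ?_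
    (hJ.preimage (continuous_resultant l).norm))
  · simp only [Set.ofPred_forall]
    exact isClosed_iInter fun i => isClosed_eq (by fun_prop) continuous_const
  · exact isClosed_eq (by fun_prop) continuous_const

theorem descentStep_apply_base (l : ι → ℝ) (i₀ : ι) (a : ℝ) (e : ι → ℂ) :
    descentStep l i₀ a e i₀ = e i₀ := by
  simp [descentStep]

theorem descentStep_zero (l : ι → ℝ) (i₀ : ι) (e : ι → ℂ) : descentStep l i₀ 0 e = e := by
  funext i
  simp [descentStep]

/-- With `u` and `u'` the square roots of the lengths of the resultant before and after the step,
the angle by which an edge turns is at most a multiple of `u - u'`. This combines the decrease of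
`u ^ 4`, which is at least the step size times `P = ∑ lᵢ torqueᵢ²` and at most `4 u ^ 3 (u - u')`,
with `P ≥ lam * torqueᵢ²` and `P ≥ κ u ^ 6`. -/
theorem mul_abs_torque_le {l : ι → ℝ} {e : ι → ℂ} {lam κ a u u' : ℝ} (hlam : 0 < lam)
    (hl : ∀ i, lam ≤ l i) (hκ : 0 < κ) (ha : 0 ≤ a) (hu : 0 ≤ u) (hu' : 0 ≤ u')
    (hr : ‖resultant l e‖ = u ^ 2) (he : ∀ i, ‖e i‖ = 1)
    (hloj : κ * ‖resultant l e‖ ^ 3 ≤ ∑ i, l i * torque l e i ^ 2)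
    (hstep : (u' ^ 2) ^ 2 ≤ ‖resultant l e‖ ^ 2 - a * ∑ i, l i * torque l e i ^ 2) (i : ι) :
    a * |torque l e i| ≤ 4 / √(κ * lam) * (u - u') := by
  rw [hr] at hloj hstep
  set P := ∑ i, l i * torque l e i ^ 2 with hP
  have hl0 : ∀ i, 0 ≤ l i := fun i => hlam.le.trans (hl i)
  have hP0 : 0 ≤ P := Finset.sum_nonneg fun i _ => mul_nonneg (hl0 i) (sq_nonneg _)
  have huu : u' ≤ u := by
    have h1 : (u' ^ 2) ^ 2 ≤ (u ^ 2) ^ 2 := by nlinarith [mul_nonneg ha hP0]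
    have h2 := (sq_le_sq₀ (sq_nonneg u') (sq_nonneg u)).mp h1
    exact (sq_le_sq₀ hu' hu).mp h2
  have hκl : 0 < √(κ * lam) := Real.sqrt_pos.mpr (mul_pos hκ hlam)
  rcases hu.eq_or_lt with h0 | hpos
  · have h1 := abs_torque_le (l := l) he i
    rw [hr, ← h0] at h1
    have h2 : |torque l e i| = 0 := le_antisymm (by simpa using h1) (abs_nonneg _)
    rw [h2, mul_zero]
    exact mul_nonneg (by positivity) (sub_nonneg.mpr huu)
  have hPi : lam * torque l e i ^ 2 ≤ P :=
    (mul_le_mul_of_nonneg_right (hl i) (sq_nonneg _)).trans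
      (Finset.single_le_sum (f := fun i => l i * torque l e i ^ 2)
        (fun i _ => mul_nonneg (hl0 i) (sq_nonneg _)) (Finset.mem_univ i))
  have h1 : u ^ 3 * (√(κ * lam) * |torque l e i|) ≤ P := by
    refine abs_le_of_sq_le_sq' ?_ hP0 |>.2
    have h2 : (u ^ 3 * (√(κ * lam) * |torque l e i|)) ^ 2 =
        (κ * (u ^ 2) ^ 3) * (lam * torque l e i ^ 2) := by
      rw [mul_pow, mul_pow, Real.sq_sqrt (mul_pos hκ hlam).le, sq_abs]
      ring
    rw [h2, sq P]
    exact mul_le_mul hloj hPi (by positivity) hP0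
  have h3 : u ^ 3 * (a * (√(κ * lam) * |torque l e i|)) ≤ u ^ 3 * (4 * (u - u')) := by
    have h4 := mul_le_mul_of_nonneg_left h1 ha
    have h5 : (u ^ 2) ^ 2 - (u' ^ 2) ^ 2 ≤ u ^ 3 * (4 * (u - u')) := by
      have h6 : u' ^ 2 ≤ u ^ 2 := pow_le_pow_left₀ hu' huu 2
      have h7 : (u + u') * (u ^ 2 + u' ^ 2) ≤ (2 * u) * (2 * u ^ 2) :=
        mul_le_mul (by linarith) (by linarith) (by positivity) (by positivity)
      nlinarith [mul_le_mul_of_nonneg_left h7 (sub_nonneg.mpr huu)]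
    nlinarith
  have h8 := le_of_mul_le_mul_left h3 (by positivity)
  rw [div_mul_eq_mul_div, le_div_iff₀ hκl]
  linarith

/-- Under the smallness assumption, the normalized systems of directions with resultant of length
at most `c` deform to those with vanishing resultant. The potential of the descent is a multiple
of the square root of the length of the resultant. -/
theorem nonempty_homotopyEquiv_directionSlice {l : ι → ℝ} (hl : ∀ i, 0 < l i) (i₀ : ι) {c : ℝ}
    (hc : 0 < c)
    (hsmall : ∀ ε : ι → ℝ, (∀ j, ε j = 1 ∨ ε j = -1) → 0 < ∑ j, ε j * l j → c < ∑ j, ε j * l j) :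
    Nonempty (ContinuousMap.HomotopyEquiv (directionSlice l i₀ (Set.Iic c))
      (directionSlice l i₀ {0})) := by
  have : Nonempty ι := ⟨i₀⟩
  obtain ⟨i₁, hi₁⟩ := Finite.exists_min l
  set lam := l i₁
  have hlam : 0 < lam := hl i₁
  have hl0 : ∀ i, 0 ≤ l i := fun i => (hl i).le
  obtain ⟨κ, hκ, hloj⟩ := exists_lojasiewicz hl0 hc hsmall
  have hL : 0 < ∑ i, l i := Finset.sum_pos (fun i _ => hl i) Finset.univ_nonempty
  set η : ℝ := 1 / (3 * ∑ i, l i) with hη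
  have hη0 : 0 < η := by positivity
  have hηL : 3 * (∑ i, l i) * η = 1 := by rw [hη]; field_simp
  set Y := directionSlice l i₀ (Set.Iic c) with hY
  have hstep : ∀ (y : Y) (s : unitInterval),
      ‖resultant l (descentStep l i₀ (s * η) y.1)‖ ^ 2 ≤
        ‖resultant l y.1‖ ^ 2 - s * η * ∑ i, l i * torque l y.1 i ^ 2 := fun y s =>
    sq_norm_resultant_descentStep_le hl0 y.2.1 i₀ (mul_nonneg s.2.1 hη0.le) (by
      have := mul_le_of_le_one_left hη0.le s.2.2
      nlinarith)
  have hP0 : ∀ y : Y, 0 ≤ ∑ i, l i * torque l y.1 i ^ 2 := fun y =>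
    Finset.sum_nonneg fun i _ => mul_nonneg (hl0 i) (sq_nonneg _)
  have hmem : ∀ (y : Y) (s : unitInterval), descentStep l i₀ (s * η) y.1 ∈ Y := fun y s => by
    refine ⟨fun i => (norm_descentStep i₀ _ i).trans (y.2.1 i),
      (descentStep_apply_base l i₀ _ _).trans y.2.2.1, ?_⟩
    have h1 : ‖resultant l (descentStep l i₀ (s * η) y.1)‖ ^ 2 ≤ ‖resultant l y.1‖ ^ 2 :=
      (hstep y s).trans (sub_le_self _ (mul_nonneg (mul_nonneg s.2.1 hη0.le) (hP0 y)))
    exact ((sq_le_sq₀ (norm_nonneg _) (norm_nonneg _)).mp h1).trans y.2.2.2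
  let D : Y × unitInterval → Y := fun p => ⟨descentStep l i₀ (p.2 * η) p.1.1, hmem p.1 p.2⟩
  have hκl : 0 < √(κ * lam) := Real.sqrt_pos.mpr (mul_pos hκ hlam)
  set C : ℝ := 8 / √(κ * lam) with hC
  have hC0 : 0 < C := by positivity
  let u : Y → ℝ := fun y => √‖resultant l y.1‖
  have hu0 : ∀ y, 0 ≤ u y := fun y => Real.sqrt_nonneg _
  have hu2 : ∀ y : Y, ‖resultant l y.1‖ = u y ^ 2 := fun y =>
    (Real.sq_sqrt (norm_nonneg _)).symm
  have huc : Continuous u :=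
    ((continuous_resultant l).comp continuous_subtype_val).norm.sqrt
  have hstep' : ∀ y s, (u (D (y, s)) ^ 2) ^ 2 ≤
      ‖resultant l y.1‖ ^ 2 - s * η * ∑ i, l i * torque l y.1 i ^ 2 := fun y s => by
    rw [← hu2]; exact hstep y s
  have htor : ∀ y s i, s * η * |torque l y.1 i| ≤ 4 / √(κ * lam) * (u y - u (D (y, s))) :=
    fun y s i => mul_abs_torque_le hlam hi₁ hκ (mul_nonneg s.2.1 hη0.le) (hu0 y) (hu0 _) (hu2 y)
      y.2.1 (hloj y.1 y.2.1 y.2.2.2) (hstep' y s) i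
  have hdist : ∀ y s, dist y (D (y, s)) ≤ C * u y - C * u (D (y, s)) := fun y s => by
    have hbound : ∀ i, dist (y.1 i) ((D (y, s)).1 i) ≤ C * u y - C * u (D (y, s)) := fun i => by
      rw [dist_eq_norm]
      refine (norm_sub_descentStep_le y.2.1 (mul_nonneg s.2.1 hη0.le) i₀ i).trans ?_
      have h1 := htor y s i
      have h2 := htor y s i₀
      have h3 : C = 4 / √(κ * lam) + 4 / √(κ * lam) := by rw [hC]; ring
      rw [h3]
      linarith
    exact (dist_pi_le_iff (dist_nonneg.trans (hbound i₀))).mpr hbound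
  have hdec : ∀ ε > 0, ∃ δ > 0, ∀ y, ε ≤ C * u y → C * u (D (y, 1)) ≤ C * u y - δ := by
    intro ε hε
    refine ⟨C * (η * κ * (ε / C) ^ 3 / 4), by positivity, fun y hy => ?_⟩
    have hεu : ε / C ≤ u y := (div_le_iff₀ hC0).mpr (by linarith)
    have hupos : 0 < u y := (div_pos hε hC0).trans_le hεu
    have huu : u (D (y, 1)) ≤ u y := by
      have := (dist_nonneg (x := y) (y := D (y, 1))).trans (hdist y 1)
      exact le_of_mul_le_mul_left (by linarith) hC0
    -- `u ^ 4` decreases by at least `η κ u ^ 6` and by at most `4 u ^ 3` times the decrease of `u`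
    have h1 : u y ^ 3 * (η * κ * u y ^ 3) ≤ u y ^ 3 * (4 * (u y - u (D (y, 1)))) := by
      have h2 := hstep' y 1
      have h3 := mul_le_mul_of_nonneg_left (hloj y.1 y.2.1 y.2.2.2) hη0.le
      rw [hu2 y] at h2 h3
      rw [Set.Icc.coe_one, one_mul] at h2
      have h6 : u (D (y, 1)) ^ 2 ≤ u y ^ 2 := pow_le_pow_left₀ (hu0 _) huu 2
      have h7 : (u y + u (D (y, 1))) * (u y ^ 2 + u (D (y, 1)) ^ 2) ≤ (2 * u y) * (2 * u y ^ 2) :=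
        mul_le_mul (by linarith) (by linarith) (by positivity) (by positivity)
      nlinarith [mul_le_mul_of_nonneg_left h7 (sub_nonneg.mpr huu)]
    have h8 := le_of_mul_le_mul_left h1 (by positivity)
    have h9 : η * κ * (ε / C) ^ 3 ≤ η * κ * u y ^ 3 := by gcongr
    rw [← mul_sub]
    exact mul_le_mul_of_nonneg_left (by linarith) hC0.le
  have hDc : Continuous D := by
    refine Continuous.subtype_mk ?_ _
    exact (continuous_descentStep l i₀).comp
      (f := fun p : Y × unitInterval => (((p.2 : ℝ) * η, p.1.1) : ℝ × (ι → ℂ))) (by fun_prop)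
  have hcomplete : CompleteSpace Y := (isClosed_directionSlice l i₀ isClosed_Iic).completeSpace_coe
  obtain ⟨h⟩ := nonempty_homotopyEquiv_zeros (φ := fun y => C * u y) (B := C * √c) hDc
    (fun y => Subtype.ext (by simp [D, descentStep_zero])) (huc.const_mul C)
    (fun y => mul_nonneg hC0.le (hu0 y))
    (fun y => mul_le_mul_of_nonneg_left (Real.sqrt_le_sqrt y.2.2.2) hC0.le) hdist hdec
  have hzero : ∀ y : Y, C * u y = 0 ↔ ‖resultant l y.1‖ = 0 := fun y => by
    rw [mul_eq_zero, or_iff_right hC0.ne', hu2 y]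
    simp
  let Φ : {y : Y // C * u y = 0} ≃ₜ directionSlice l i₀ {0} :=
    { toFun := fun y => ⟨y.1.1, y.1.2.1, y.1.2.2.1, (hzero y.1).mp y.2⟩
      invFun := fun e => ⟨⟨e.1, e.2.1, e.2.2.1, by
        have h0 : ‖resultant l e.1‖ = 0 := e.2.2.2
        exact h0.trans_le hc.le⟩, (hzero _).mpr e.2.2.2⟩
      left_inv := fun _ => rfl
      right_inv := fun _ => rfl
      continuous_toFun := by fun_prop
      continuous_invFun := by fun_prop }
  exact ⟨h.trans Φ.toHomotopyEquiv⟩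

end

/-! ### Shape spaces as spaces of edge directions -/

/-- Two chains differ by an orientation preserving isometry of the plane exactly if they differ by
a map `z ↦ a z + b` with `|a| = 1`. -/
theorem exists_planeMotion_iff {ι : Type*} (z w : ι → ℂ) :
    (∃ g ∈ planeMotions, ∀ i, w i = g (z i)) ↔
      ∃ a b : ℂ, ‖a‖ = 1 ∧ ∀ i, w i = a * z i + b := by
  constructor
  · rintro ⟨g, hg, h⟩
    have hgz : ∀ x, g x = g.linearIsometryEquiv x + g 0 := fun x => by
      simpa using g.map_vadd 0 x
    obtain ⟨a, ha | ha⟩ := linear_isometry_complex g.linearIsometryEquiv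
    · refine ⟨a, g 0, Circle.norm_coe a, fun i => ?_⟩
      rw [h i, hgz, ha, rotation_apply]
    · exfalso
      have hdet : 0 < LinearMap.det (g.linearIsometryEquiv.toLinearEquiv : ℂ →ₗ[ℝ] ℂ) := hg
      have : (g.linearIsometryEquiv.toLinearEquiv : ℂ →ₗ[ℝ] ℂ) =
          ((rotation a).toLinearEquiv : ℂ →ₗ[ℝ] ℂ) ∘ₗ
            (Complex.conjLIE.toLinearEquiv : ℂ →ₗ[ℝ] ℂ) := by
        rw [ha]; rfl
      rw [this, LinearMap.det_comp, det_rotation, Complex.det_conjLIE] at hdet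
      norm_num at hdet
  · rintro ⟨a, b, ha, h⟩
    let a' : Circle := ⟨a, mem_sphere_zero_iff_norm.mpr ha⟩
    let g : ℂ ≃ᵃⁱ[ℝ] ℂ := AffineIsometryEquiv.mk' (fun x => a * x + b) (rotation a') 0 (by
      intro x
      simp only [a', mul_zero, zero_add, vsub_eq_sub, sub_zero, vadd_eq_add]
      rfl)
    refine ⟨g, ?_, fun i => h i⟩
    have : g.linearIsometryEquiv = rotation a' :=
      AffineIsometryEquiv.linearIsometryEquiv_mk' _ _ _ _
    change 0 < LinearMap.det (g.linearIsometryEquiv.toLinearEquiv : ℂ →ₗ[ℝ] ℂ)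
    rw [this, det_rotation]
    exact one_pos

/-- The edge of a closed chain from its vertex number `j` to its vertex number `j + 1`, with
cyclic numbering. -/
noncomputable def edge {N : ℕ} [NeZero N] (z : Fin N → ℂ) (j : ℕ) : ℂ :=
  z (Fin.ofNat N (j + 1)) - z (Fin.ofNat N j)

/-- The sum of the first `k` terms of a finite family; it is the `k`-th vertex of the chain that
starts at `0` and has these edges. -/
noncomputable def partialSum {n : ℕ} (u : Fin n → ℂ) (k : ℕ) : ℂ :=
  ∑ j : Fin n, if (j : ℕ) < k then u j else 0

theorem partialSum_zero {n : ℕ} (u : Fin n → ℂ) : partialSum u 0 = 0 := by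
  simp [partialSum]

theorem partialSum_self {n : ℕ} (u : Fin n → ℂ) : partialSum u n = ∑ j, u j := by
  simp [partialSum]

theorem partialSum_succ {n : ℕ} (u : Fin n → ℂ) (j : Fin n) :
    partialSum u (j + 1) = partialSum u j + u j := by
  rw [partialSum, partialSum, ← sub_eq_iff_eq_add', ← Finset.sum_sub_distrib]
  rw [Finset.sum_eq_single j]
  · simp
  · intro i _ hij
    have : (i : ℕ) ≠ j := fun h => hij (Fin.ext h)
    by_cases h : (i : ℕ) < j
    · simp [h, Nat.lt_succ_of_lt h]
    · have h' : ¬ (i : ℕ) < j + 1 := by omega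
      simp [h, h']
  · simp

theorem partialSum_mul_left {n : ℕ} (c : ℂ) (u : Fin n → ℂ) (k : ℕ) :
    partialSum (fun j => c * u j) k = c * partialSum u k := by
  simp [partialSum, Finset.mul_sum]

theorem partialSum_edge {N n : ℕ} [NeZero N] (z : Fin N → ℂ) {k : ℕ} (hk : k ≤ n) :
    partialSum (fun j : Fin n => edge z j) k = z (Fin.ofNat N k) - z 0 := by
  induction k with
  | zero => simp [partialSum_zero]
  | succ k ih =>
    have := partialSum_succ (fun j : Fin n => edge z j) ⟨k, hk⟩
    simp only at this
    rw [this, ih (Nat.le_of_succ_le hk), edge]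
    ring

theorem edge_mul_add {N : ℕ} [NeZero N] {z w : Fin N → ℂ} {a b : ℂ} (h : ∀ i, w i = a * z i + b)
    (j : ℕ) : edge w j = a * edge z j := by
  simp only [edge, h]
  ring

/-- A quotient is homeomorphic to any space parametrizing its classes by a continuous family of
representatives, provided that the parameter of a class is a continuous function of its
elements. -/
theorem nonempty_homeomorph_of_slice {X Z : Type*} [TopologicalSpace X] [TopologicalSpace Z]
    (s : Setoid X) {f : X → Z} {g : Z → X} (hf : Continuous f) (hg : Continuous g)
    (hfs : ∀ x y, s.r x y → f x = f y) (hfg : ∀ z, f (g z) = z) (hgf : ∀ x, s.r (g (f x)) x) :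
    Nonempty (Quotient s ≃ₜ Z) :=
  ⟨{ toFun := Quotient.lift f hfs
     invFun := fun z => Quotient.mk s (g z)
     left_inv := by
       rintro ⟨x⟩
       exact Quotient.sound (hgf x)
     right_inv := hfg
     continuous_toFun := hf.quotient_lift hfs
     continuous_invFun := continuous_quotient_mk'.comp hg }⟩

/-- Chains with `m + 1` edges of given lengths whose resultant has length in `J`, modulo motions,
are parametrized by the edge directions relative to the direction of the edge `0`. The number `N`
of vertices is `m + 1` for closed chains and `m + 2` for chains with free endpoints. -/
theorem nonempty_homeomorph_directionSlice {m N : ℕ} [NeZero N] (hN : N ≤ m + 2)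
    {l : Fin (m + 1) → ℝ} (hl : ∀ i, 0 < l i) {B : Set (Fin N → ℝ)} {J : Set ℝ}
    (hB : ∀ z : Fin N → ℂ, sideLengths z ∈ B ↔
      (∀ j : Fin (m + 1), ‖edge z j‖ = l j) ∧ ‖∑ j : Fin (m + 1), edge z j‖ ∈ J)
    (hedge : ∀ u : Fin (m + 1) → ℂ, ‖∑ j, u j‖ ∈ J →
      ∀ j : Fin (m + 1), edge (fun k : Fin N => partialSum u k) j = u j) :
    Nonempty (ShapeSpace B ≃ₜ directionSlice l 0 J) := by
  have hlC : ∀ i, (l i : ℂ) ≠ 0 := fun i => Complex.ofReal_ne_zero.mpr (hl i).ne'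
  have hnl : ∀ i, ‖(l i : ℂ)‖ = l i := fun i => by
    rw [Complex.norm_real, Real.norm_eq_abs, abs_of_pos (hl i)]
  have hne : ∀ z : sideLengths ⁻¹' B, edge z.1 0 ≠ 0 := fun z h0 => by
    have := ((hB z.1).mp z.2).1 0
    rw [Fin.val_zero, h0, norm_zero] at this
    exact (hl 0).ne this
  let F : (Fin N → ℂ) → Fin (m + 1) → ℂ := fun z i => (l 0 / edge z 0) * (edge z i / l i)
  have hlF : ∀ (z : Fin N → ℂ) i, (l i : ℂ) * F z i = l 0 / edge z 0 * edge z i := fun z i => by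
    simp only [F]
    field_simp [hlC i]
  have hc : ∀ z : sideLengths ⁻¹' B, ‖(l 0 : ℂ) / edge z.1 0‖ = 1 := fun z => by
    have h0 := ((hB z.1).mp z.2).1 0
    rw [Fin.val_zero] at h0
    rw [norm_div, h0, hnl, div_self (hl 0).ne']
  have hF : ∀ z : sideLengths ⁻¹' B, F z.1 ∈ directionSlice l 0 J := fun z => by
    have hz := (hB z.1).mp z.2
    refine ⟨fun i => ?_, ?_, ?_⟩
    · simp only [F]
      rw [norm_mul, hc, one_mul, norm_div, hz.1 i, hnl, div_self (hl i).ne']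
    · simp only [F, Fin.val_zero]
      field_simp [hlC 0, hne z]
    · have : resultant l (F z.1) = l 0 / edge z.1 0 * ∑ j : Fin (m + 1), edge z.1 j := by
        simp only [resultant, hlF, Finset.mul_sum]
      rw [this, norm_mul, hc, one_mul]
      exact hz.2
  let G : (Fin (m + 1) → ℂ) → Fin N → ℂ := fun e k => partialSum (fun j => (l j : ℂ) * e j) k
  have hGe : ∀ e ∈ directionSlice l 0 J, ∀ j : Fin (m + 1), edge (G e) j = l j * e j :=
    fun e he j => hedge _ he.2.2 j
  have hG : ∀ e : directionSlice l 0 J, sideLengths (G e.1) ∈ B := fun e => by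
    refine (hB _).mpr ⟨fun j => ?_, ?_⟩
    · rw [hGe _ e.2, norm_mul, e.2.1 j, mul_one, hnl]
    · simp only [hGe _ e.2]
      exact e.2.2.2
  refine nonempty_homeomorph_of_slice _ (f := fun z => ⟨F z.1, hF z⟩) (g := fun e => ⟨G e.1, hG e⟩)
    ?_ ?_ ?_ ?_ ?_
  · refine Continuous.subtype_mk (continuous_pi fun i => ?_) _
    have hedgec : ∀ j, Continuous fun z : sideLengths ⁻¹' B => edge z.1 j := fun j => by
      exact ((continuous_apply _).comp continuous_subtype_val).sub
        ((continuous_apply _).comp continuous_subtype_val)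
    exact (continuous_const.div (hedgec 0) hne).mul ((hedgec i).div_const _)
  · refine Continuous.subtype_mk (continuous_pi fun k => ?_) _
    simp only [G, partialSum]
    refine continuous_finsetSum _ fun j _ => ?_
    split_ifs
    · exact continuous_const.mul ((continuous_apply j).comp continuous_subtype_val)
    · exact continuous_const
  · intro z w h
    obtain ⟨a, b, ha, hab⟩ := (exists_planeMotion_iff _ _).mp h
    have ha0 : a ≠ 0 := fun h0 => by simp [h0] at ha
    refine Subtype.ext (funext fun i => ?_)
    simp only [F, edge_mul_add hab]
    field_simp [hne z, ha0, hlC i]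
  · intro e
    refine Subtype.ext (funext fun i => ?_)
    have h0 := hGe e.1 e.2 0
    rw [e.2.2.1, mul_one, Fin.val_zero] at h0
    change (l 0 : ℂ) / edge (G e.1) 0 * (edge (G e.1) i / l i) = e.1 i
    rw [h0, hGe e.1 e.2 i]
    field_simp [hlC i, hlC 0]
  · intro z
    refine Setoid.symm' _ ((exists_planeMotion_iff _ _).mpr
      ⟨l 0 / edge z.1 0, -(l 0 / edge z.1 0 * z.1 0), hc z, fun k => ?_⟩)
    have hk : (k : ℕ) ≤ m + 1 := by omega
    change partialSum (fun j => (l j : ℂ) * F z.1 j) k = _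
    simp only [hlF]
    rw [partialSum_mul_left, partialSum_edge z.1 hk, Fin.ofNat_eq_cast, Fin.cast_val_eq_self]
    ring

/-- Membership in the segment of side lengths of a chain with a telescopic last side. -/
theorem mem_segment_update_last_iff {n : ℕ} {l x : Fin (n + 1) → ℝ} (hl : 0 < l (Fin.last n)) :
    x ∈ segment ℝ (Function.update l (Fin.last n) 0) l ↔
      (∀ j : Fin n, x j.castSucc = l j.castSucc) ∧
        0 ≤ x (Fin.last n) ∧ x (Fin.last n) ≤ l (Fin.last n) := by
  rw [segment_eq_image]
  constructor
  · rintro ⟨t, ht, rfl⟩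
    refine ⟨fun j => ?_, ?_, ?_⟩
    · simp
      ring
    · simpa using mul_nonneg ht.1 hl.le
    · simpa using mul_le_of_le_one_left hl.le ht.2
  · rintro ⟨h1, h2, h3⟩
    refine ⟨x (Fin.last n) / l (Fin.last n), ⟨by positivity, (div_le_one hl).mpr h3⟩, ?_⟩
    funext i
    refine Fin.lastCases ?_ (fun j => ?_) i
    · simp [hl.ne']
    · simp [h1 j]
      ring

theorem nonempty_homeomorph_telescopicSpace {m : ℕ} {l : Fin (m + 2) → ℝ} (hl : ∀ i, 0 < l i) :
    Nonempty (TelescopicSpace l ≃ₜ directionSlice (fun j : Fin (m + 1) => l j.castSucc) 0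
      (Set.Iic (l (Fin.last (m + 1))))) := by
  have hcast : ∀ j : Fin (m + 1), Fin.ofNat (m + 2) (j : ℕ) = j.castSucc := fun j =>
    Fin.ext (Nat.mod_eq_of_lt (by omega))
  have hsucc : ∀ j : Fin (m + 1), Fin.ofNat (m + 2) ((j : ℕ) + 1) = j.succ := fun j =>
    Fin.ext (Nat.mod_eq_of_lt (by omega))
  refine nonempty_homeomorph_directionSlice le_rfl (fun i => hl i.castSucc) (fun z => ?_)
    fun u _ j => ?_
  · have h1 : ∀ j : Fin (m + 1), sideLengths z j.castSucc = ‖edge z j‖ := fun j => by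
      rw [sideLengths, edge, hcast, hsucc, finRotate_apply, Fin.coeSucc_eq_succ]
    have h2 : sideLengths z (Fin.last (m + 1)) = ‖∑ j : Fin (m + 1), edge z j‖ := by
      rw [← partialSum_self, partialSum_edge z le_rfl, sideLengths, finRotate_last, norm_sub_rev]
      congr 3
      exact Fin.ext (by simp)
    rw [mem_segment_update_last_iff (hl _)]
    simp only [h1, h2, norm_nonneg, true_and, Set.mem_Iic]
  · rw [edge, hcast, hsucc, Fin.val_succ, Fin.val_castSucc, partialSum_succ]
    ring

theorem nonempty_homeomorph_polygonSpace {m : ℕ} {l : Fin (m + 1) → ℝ} (hl : ∀ i, 0 < l i) :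
    Nonempty (PolygonSpace l ≃ₜ directionSlice l 0 {0}) := by
  have hcast : ∀ j : Fin (m + 1), Fin.ofNat (m + 1) (j : ℕ) = j := fun j =>
    Fin.ext (Nat.mod_eq_of_lt j.2)
  have hsucc : ∀ j : Fin (m + 1), Fin.ofNat (m + 1) ((j : ℕ) + 1) = finRotate (m + 1) j :=
    fun j => by
      rw [finRotate_apply]
      exact Fin.ext (by simp [Fin.val_add])
  refine nonempty_homeomorph_directionSlice (Nat.le_succ _) hl (fun z => ?_) fun u hu j => ?_
  · have h1 : sideLengths z = fun j : Fin (m + 1) => ‖edge z j‖ := funext fun j => by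
      rw [sideLengths, edge, hcast, hsucc]
    have h2 : ∑ j : Fin (m + 1), edge z j = 0 := by
      simp only [edge, hcast, hsucc, Finset.sum_sub_distrib]
      rw [Equiv.sum_comp (finRotate (m + 1)) z, sub_self]
    rw [h2, h1]
    simp [funext_iff]
  -- the last edge leads back to the vertex `0`, as the edges sum up to zero
  · have h3 : partialSum u (finRotate (m + 1) j : Fin (m + 1)) = partialSum u ((j : ℕ) + 1) := by
      refine Fin.lastCases ?_ (fun i => ?_) j
      · have h0 : ∑ j, u j = 0 := by simpa using hu
        rw [finRotate_last, Fin.val_zero, partialSum_zero, Fin.val_last, partialSum_self, h0]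
      · rw [finRotate_apply, Fin.coeSucc_eq_succ, Fin.val_succ, Fin.val_castSucc]
    rw [edge, hcast, hsucc, h3, partialSum_succ]
    ring

/-- Chains with at most one vertex have just one shape. -/
theorem subsingleton_shapeSpace {n : ℕ} (hn : n ≤ 1) (B : Set (Fin n → ℝ)) :
    Subsingleton (ShapeSpace B) := by
  have : Subsingleton (Fin n) := Fin.subsingleton_iff_le_one.mpr hn
  refine ⟨?_⟩
  rintro ⟨z⟩ ⟨w⟩
  refine Quotient.sound ((exists_planeMotion_iff z.1 w.1).mpr ?_)
  rcases isEmpty_or_nonempty (Fin n) with h | ⟨⟨i₀⟩⟩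
  · exact ⟨1, 0, norm_one, fun i => h.elim i⟩
  · refine ⟨1, w.1 i₀ - z.1 i₀, norm_one, fun i => ?_⟩
    rw [Subsingleton.elim i i₀]
    ring

theorem corollary2 (n : ℕ) (l : Fin (n + 1) → ℝ) (hpos : ∀ i, 0 < l i)
    (hsmall : ∀ ε : Fin n → ℝ, (∀ j, ε j = 1 ∨ ε j = -1) →
      0 < ∑ j, ε j * l j.castSucc → l (Fin.last n) < ∑ j, ε j * l j.castSucc) :
    Nonempty (ContinuousMap.HomotopyEquiv (TelescopicSpace l)
      (PolygonSpace (fun j : Fin n => l j.castSucc))) := by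
  rcases n with _ | m
  -- both spaces are points
  · have := subsingleton_shapeSpace le_rfl (segment ℝ (Function.update l (Fin.last 0) 0) l)
    have := subsingleton_shapeSpace zero_le_one {fun j : Fin 0 => l j.castSucc}
    let p : TelescopicSpace l := Quotient.mk _ ⟨0, (mem_segment_update_last_iff (hpos _)).mpr
      ⟨fun j => j.elim0, by simp [sideLengths], by simpa [sideLengths] using (hpos 0).le⟩⟩
    let q : PolygonSpace (fun j : Fin 0 => l j.castSucc) :=
      Quotient.mk _ ⟨0, funext fun j => j.elim0⟩
    have := Unique.mk' (h₁ := ⟨p⟩)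
    have := Unique.mk' (h₁ := ⟨q⟩)
    exact ⟨(Homeomorph.homeomorphOfUnique _ _).toHomotopyEquiv⟩
  · obtain ⟨h₁⟩ := nonempty_homeomorph_telescopicSpace hpos
    obtain ⟨h₂⟩ := nonempty_homeomorph_polygonSpace fun j : Fin (m + 1) => hpos j.castSucc
    obtain ⟨h⟩ := nonempty_homotopyEquiv_directionSlice (fun j : Fin (m + 1) => hpos j.castSucc) 0
      (hpos (Fin.last (m + 1))) hsmall
    exact ⟨(h₁.toHomotopyEquiv.trans h).trans h₂.symm.toHomotopyEquiv⟩
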